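/- Let $d,J\in\mathbb{N}$, let $x_1,\dots,x_J\in\mathbb{R}^d$ (the plan), $\rho\in\mathbb{R}_+$, $\hat\mu\in\mathbb{R}^d$ and let $\hat\Sigma\in\mathbb{S}^d_+$ be a symmetric positive semidefinite $d\times d$ matrix. For $(\mu_1,\Sigma_1),(\mu_2,\Sigma_2)\in\mathbb{R}^d\times\mathbb{S}^d_+$ define the Gelbrich distance $$\mathbb{G}\big((\mu_1,\Sigma_1),(\mu_2,\Sigma_2)\big)=\sqrt{\|\mu_1-\mu_2\|_2^2+\mathrm{Tr}\big(\Sigma_1+\Sigma_2-2(\Sigma_2^{1/2}\Sigma_1\Sigma_2^{1/2})^{1/2}\big)}.$$ Let $\mathbb{B}$ be the set of all Borel probability measures $\mathbb{Q}$ on $\mathbb{R}^d$ with finite second moments whose mean vector $\mu$ and covariance matrix $\Sigma$ satisfy $\mathbb{G}\big((\mu,\Sigma),(\hat\mu,\hat\Sigma)\big)\le\rho$. Put $$\Theta=\{\theta\in\mathbb{R}^d: x_j^\top\theta\ge 0\ \text{for all } j=1,\dots,J\},\qquad \Theta^\circ=\{\theta\in\mathbb{R}^d: x_j^\top\theta>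 0\ \text{for all } j=1,\dots,J\},$$ so that the plan is valid for the parameter $\theta$ exactly when $\theta\in\Theta$. Let $L^\star$ be the optimal value of the linear semidefinite program $$\begin{array}{cl} \inf & 1-\sum_{j=1}^J\lambda_j\\ \text{s.t.} & \mu\in\mathbb{R}^d,\ \Sigma\in\mathbb{S}^d_+,\ C\in\mathbb{R}^{d\times d},\ M\in\mathbb{S}^d_+,\quad \lambda_j\in\mathbb{R},\ z_j\in\mathbb{R}^d,\ Z_j\in\mathbb{S}^d\ \ (j=1,\dots,J),\\[4pt] & -x_j^\top z_j\ge 0,\quad \begin{bmatrix} Z_j & z_j\\ z_j^\top & \lambda_j\end{bmatrix}\succeq 0\ \ (j=1,\dots,J),\\[8pt] & \displaystyle\sum_{j=1}^J\begin{bmatrix} Z_j & z_j\\ z_j^\top & \lambda_j\end{bmatrix}\preceq\begin{bmatrix} M & \mu\\ \mu^\top & 1\end{bmatrix},\quad \begin{bmatrix}\Sigma & C\\ C^\top & \hat\Sigma\end{bmatrix}\succeq 0,\quad \begin{bmatrix} M-\Sigma & \mu\\ \mu^\top & 1\end{bmatrix}\succeq 0,\\[8pt] & \|\hat\mu\|_2^2-2\hat\mu^\top\mu+\mathrm{Tr}(M+\hat\Sigma-2C)\le\rho^2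 . \end{array}$$ Then this program is feasible with finite optimal value, $\mathbb{B}$ is nonempty, and $$L^\star=\inf_{\mathbb{Q}\in\mathbb{B}}\mathbb{Q}(\Theta^\circ)\ \le\ \inf_{\mathbb{Q}\in\mathbb{B}}\mathbb{Q}(\Theta).$$ -/

import Mathlib

open MeasureTheory

namespace CounterfactualPlan

open scoped MatrixOrder in
/-- The Gelbrich distance between two mean-covariance pairs: the square root of
`‖μ₁ - μ₂‖₂² + Tr (S₁ + S₂ - 2 (S₂^{1/2} S₁ S₂^{1/2})^{1/2})`. For a positive semidefinite
matrix `A`, `CFC.sqrt A` is its unique positive semidefinite square root. -/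
noncomputable def gelbrichDist {d : ℕ}
    (μ₁ : EuclideanSpace ℝ (Fin d)) (S₁ : Matrix (Fin d) (Fin d) ℝ)
    (μ₂ : EuclideanSpace ℝ (Fin d)) (S₂ : Matrix (Fin d) (Fin d) ℝ) : ℝ :=
  Real.sqrt (‖μ₁ - μ₂‖ ^ 2 +
    (S₁ + S₂ - (2 : ℝ) • CFC.sqrt (CFC.sqrt S₂ * S₁ * CFC.sqrt S₂)).trace)

/-- The probability measure `Q` on `ℝ^d` has finite second moments, mean vector `μ` and
covariance matrix `S`. -/
def HasMeanCov {d : ℕ} (Q : ProbabilityMeasure (EuclideanSpace ℝ (Fin d)))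
    (μ : EuclideanSpace ℝ (Fin d)) (S : Matrix (Fin d) (Fin d) ℝ) : Prop :=
  MemLp (fun θ : EuclideanSpace ℝ (Fin d) => θ) 2 (Q : Measure (EuclideanSpace ℝ (Fin d))) ∧
  ∫ θ, θ ∂(Q : Measure (EuclideanSpace ℝ (Fin d))) = μ ∧
  ∀ i k : Fin d, ProbabilityTheory.covariance
    (fun θ : EuclideanSpace ℝ (Fin d) => θ i) (fun θ : EuclideanSpace ℝ (Fin d) => θ k)
    (Q : Measure (EuclideanSpace ℝ (Fin d))) = S i k

/-- The set of mean-covariance pairs within Gelbrich distance `ρ` of the nominal pair. -/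
def momentSet {d : ℕ} (μhat : EuclideanSpace ℝ (Fin d)) (Shat : Matrix (Fin d) (Fin d) ℝ)
    (ρ : ℝ) : Set (EuclideanSpace ℝ (Fin d) × Matrix (Fin d) (Fin d) ℝ) :=
  {p | p.2.PosSemidef ∧ gelbrichDist p.1 p.2 μhat Shat ≤ ρ}

/-- The set of all probability measures on `ℝ^d` whose mean and covariance lie in the moment
set. -/
def ambiguitySet {d : ℕ} (μhat : EuclideanSpace ℝ (Fin d)) (Shat : Matrix (Fin d) (Fin d) ℝ)
    (ρ : ℝ) : Set (ProbabilityMeasure (EuclideanSpace ℝ (Fin d))) :=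
  {Q | ∃ p ∈ momentSet μhat Shat ρ, HasMeanCov Q p.1 p.2}

/-- The set `Θ({x_j})` of favorable parameters: those for which the plan is jointly valid. -/
def favorable {d J : ℕ} (x : Fin J → EuclideanSpace ℝ (Fin d)) :
    Set (EuclideanSpace ℝ (Fin d)) :=
  {θ | ∀ j, 0 ≤ inner ℝ (x j) θ}

/-- The set `Θ°({x_j})`, defined by the strict inequalities. -/
def strictlyFavorable {d J : ℕ} (x : Fin J → EuclideanSpace ℝ (Fin d)) :
    Set (EuclideanSpace ℝ (Fin d)) :=
  {θ | ∀ j, 0 < inner ℝ (x j) θ}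

/-- The bordered matrix with blocks `[A, v; vᵀ, c]`. -/
def bordered {d : ℕ} (A : Matrix (Fin d) (Fin d) ℝ) (v : EuclideanSpace ℝ (Fin d)) (c : ℝ) :
    Matrix (Fin d ⊕ Unit) (Fin d ⊕ Unit) ℝ :=
  Matrix.fromBlocks A (Matrix.replicateCol Unit v.ofLp) (Matrix.replicateRow Unit v.ofLp)
    (Matrix.of fun _ _ => c)

/-- The decision variables of the semidefinite program. -/
structure SDPVars (d J : ℕ) where
  μ : EuclideanSpace ℝ (Fin d)
  S : Matrix (Fin d) (Fin d) ℝ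
  C : Matrix (Fin d) (Fin d) ℝ
  M : Matrix (Fin d) (Fin d) ℝ
  lam : Fin J → ℝ
  z : Fin J → EuclideanSpace ℝ (Fin d)
  Z : Fin J → Matrix (Fin d) (Fin d) ℝ

/-- The constraints of the semidefinite program. -/
structure SDPVars.Feasible {d J : ℕ} (v : SDPVars d J) (x : Fin J → EuclideanSpace ℝ (Fin d))
    (μhat : EuclideanSpace ℝ (Fin d)) (Shat : Matrix (Fin d) (Fin d) ℝ) (ρ : ℝ) : Prop where
  S_psd : v.S.PosSemidef
  M_psd : v.M.PosSemidef
  Z_symm : ∀ j, (v.Z j).IsSymm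
  halfspace : ∀ j, 0 ≤ -inner ℝ (x j) (v.z j)
  block_psd : ∀ j, (bordered (v.Z j) (v.z j) (v.lam j)).PosSemidef
  sum_le : (bordered v.M v.μ 1 - ∑ j, bordered (v.Z j) (v.z j) (v.lam j)).PosSemidef
  coupling : (Matrix.fromBlocks v.S v.C v.C.transpose Shat).PosSemidef
  schur : (bordered (v.M - v.S) v.μ 1).PosSemidef
  radius : ‖μhat‖ ^ 2 - 2 * inner ℝ μhat v.μ + (v.M + Shat - (2 : ℝ) • v.C).trace ≤ ρ ^ 2

/-- The objective function of the semidefinite program. -/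
def SDPVars.objective {d J : ℕ} (v : SDPVars d J) : ℝ := 1 - ∑ j, v.lam j

/-- The set of objective values attained at feasible points of the semidefinite program. -/
def sdpValues {d J : ℕ} (x : Fin J → EuclideanSpace ℝ (Fin d))
    (μhat : EuclideanSpace ℝ (Fin d)) (Shat : Matrix (Fin d) (Fin d) ℝ) (ρ : ℝ) : Set ℝ :=
  {t | ∃ v : SDPVars d J, v.Feasible x μhat Shat ρ ∧ t = v.objective}

/-- The optimal value `L⋆` of the semidefinite program. -/
noncomputable def sdpOptimalValue {d J : ℕ} (x : Fin J → EuclideanSpace ℝ (Fin d))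
    (μhat : EuclideanSpace ℝ (Fin d)) (Shat : Matrix (Fin d) (Fin d) ℝ) (ρ : ℝ) : ℝ :=
  sInf (sdpValues x μhat Shat ρ)

end CounterfactualPlan

/-! A law and a feasible point are both decompositions of the second-moment matrix [M, μ; μᵀ, 1]
into positive semidefinite blocks.

From a law Q, cut the complement of Θ° into cells according to the first j with x_jᵀθ ≤ 0. The
moments of Q on these cells give the blocks (Z_j, z_j, λ_j), the moments on Θ° are the slack of the
sum constraint, and 1 - ∑ λ_j = Q(Θ°): `real_strictlyFavorable_mem_sdpValues`.

From a feasible point, take for each block, the slack included, an atom at its mean with its corner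
as mass. The atoms z_j/λ_j avoid Θ°. The total mean is right but the second moment may be too small;
mixing in, with weight ε, a law whose covariance grows like 1/ε repairs it at the cost ε:
`SDPVars.Feasible.exists_mem_ambiguitySet`. These atoms may lie on the boundary of Θ, so the
argument gives equality for Θ° only.

The Gelbrich radius becomes linear because the trace of (Σ₂^{1/2} Σ₁ Σ₂^{1/2})^{1/2} is the maximum
of Tr C over positive semidefinite [Σ₁, C; Cᵀ, Σ₂]: `trace_le_of_fromBlocks_posSemidef` and
`exists_fromBlocks_posSemidef_trace_eq`. -/

namespace CounterfactualPlan

open Matrix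
open scoped MatrixOrder

/-! ### Polar factors and the variational formula for the fidelity. -/

/-- A real matrix `K` with `Kᵀ K = P²` for a symmetric `P` factors as `U P` with `U` a
contraction (a partial isometry). -/
theorem exists_polar_factor {m n : Type*} [Fintype m] [Fintype n] [DecidableEq n]
    (K : Matrix m n ℝ) (P : Matrix n n ℝ) (hP : P.IsHermitian) (h : Kᵀ * K = P * P) :
    ∃ U : Matrix m n ℝ, K = U * P ∧ Kᵀ * U = P ∧ (1 - Uᵀ * U).PosSemidef := by
  have hsa : IsSelfAdjoint P := hP
  have hc : ∀ f : ℝ → ℝ, ContinuousOn f (spectrum ℝ P) :=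
    fun f => (Matrix.finite_real_spectrum (A := P)).continuousOn f
  -- `G` is the pseudo-inverse of `P`: since `0⁻¹ = 0`, the function t ↦ t⁻¹ inverts `P` on its
  -- range and vanishes on its kernel. Thus `P * G` is the projection onto the range.
  obtain ⟨G, hGt, hGP, hPGP⟩ : ∃ G : Matrix n n ℝ, Gᵀ = G ∧ G * P = P * G ∧ P * G * P = P := by
    refine ⟨cfc (fun t : ℝ => t⁻¹) P, ?_, ?_, ?_⟩
    · have : IsSelfAdjoint (cfc (fun t : ℝ => t⁻¹) P) := cfc_predicate _ P
      simpa [IsSelfAdjoint, star_eq_conjTranspose] using this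
    · have := (cfc_commute_cfc (fun t : ℝ => t⁻¹) id P).eq
      rwa [cfc_id ℝ P] at this
    · calc P * cfc (fun t : ℝ => t⁻¹) P * P
          = cfc (id : ℝ → ℝ) P * cfc (fun t : ℝ => t⁻¹) P * cfc (id : ℝ → ℝ) P := by
            rw [cfc_id ℝ P]
        _ = cfc (id : ℝ → ℝ) P := by
            rw [← cfc_mul _ _ P (hc _) (hc _), ← cfc_mul _ _ P (hc _) (hc _)]
            exact congrArg (fun f => cfc f P) (funext fun t => mul_inv_mul_cancel t)
        _ = P := cfc_id ℝ P
  have hPt : Pᵀ = P := by rwa [← conjTranspose_eq_transpose_of_trivial]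
  have hE2 : (P * G) * (P * G) = P * G := by rw [← mul_assoc, hPGP]
  have hEt : (P * G)ᵀ = P * G := by rw [transpose_mul, hGt, hPt, hGP]
  have hPE : P * (P * G) = P := by rw [← hGP, ← mul_assoc, hPGP]
  -- `K` vanishes on the kernel of `P`, because Kᵀ K = P².
  have hK : K * (1 - P * G) = 0 := by
    rw [← conjTranspose_mul_self_eq_zero, conjTranspose_eq_transpose_of_trivial, transpose_mul,
      Matrix.mul_assoc, ← Matrix.mul_assoc Kᵀ, h, Matrix.mul_assoc P, Matrix.mul_sub, hPE]
    simp
  refine ⟨K * G, ?_, ?_, ?_⟩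
  · rw [Matrix.mul_sub, Matrix.mul_one, sub_eq_zero] at hK
    rw [Matrix.mul_assoc, hGP, ← hK]
  · rw [← Matrix.mul_assoc, h, Matrix.mul_assoc, hPE]
  -- The defect of `U = K * G` is the projection onto the kernel of `P`.
  · have : 1 - (K * G)ᵀ * (K * G) = (1 - P * G)ᴴ * (1 - P * G) := by
      rw [conjTranspose_eq_transpose_of_trivial, transpose_sub, hEt, transpose_one, transpose_mul,
        hGt, Matrix.mul_assoc, ← Matrix.mul_assoc Kᵀ, h, Matrix.mul_assoc P, hPE, hGP]
      noncomm_ring [hE2]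
    rw [this]
    exact posSemidef_conjTranspose_mul_self _

section

variable {n : Type*} [Fintype n] [DecidableEq n]

theorem sqrt_transpose (A : Matrix n n ℝ) : (CFC.sqrt A)ᵀ = CFC.sqrt A := by
  rw [← conjTranspose_eq_transpose_of_trivial]
  exact (CFC.sqrt_nonneg A).posSemidef.isHermitian

theorem sqrt_mul_mul_sqrt_posSemidef {A : Matrix n n ℝ} (B : Matrix n n ℝ) (hA : A.PosSemidef) :
    (CFC.sqrt B * A * CFC.sqrt B).PosSemidef := by
  simpa [sqrt_transpose] using hA.conjTranspose_mul_mul_same (CFC.sqrt B)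

theorem trace_mul_nonneg {P X : Matrix n n ℝ} (hP : P.PosSemidef) (hX : X.PosSemidef) :
    0 ≤ (P * X).trace := by
  rw [← CFC.sqrt_mul_sqrt_self P hP.nonneg, Matrix.mul_assoc, trace_mul_comm]
  exact (sqrt_mul_mul_sqrt_posSemidef P hX).trace_nonneg

/-- The off-diagonal block of a positive semidefinite block matrix has trace at most the
fidelity of the diagonal blocks. -/
theorem trace_le_of_fromBlocks_posSemidef {A B C : Matrix n n ℝ}
    (h : (fromBlocks A C Cᵀ B).PosSemidef) :
    C.trace ≤ (CFC.sqrt (CFC.sqrt B * A * CFC.sqrt B)).trace := by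
  have hA : A.PosSemidef := h.submatrix Sum.inl
  have hB : B.PosSemidef := h.submatrix Sum.inr
  obtain ⟨W, hW⟩ : ∃ W, fromBlocks A C Cᵀ B = Wᵀ * W :=
    ⟨CFC.sqrt _, by rw [sqrt_transpose, CFC.sqrt_mul_sqrt_self _ h.nonneg]⟩
  set S := CFC.sqrt B with hS
  have hSS : S * S = B := CFC.sqrt_mul_sqrt_self B hB.nonneg
  have hSt : Sᵀ = S := sqrt_transpose B
  set P := CFC.sqrt (S * A * S) with hPdef
  have hPP : P * P = S * A * S :=
    CFC.sqrt_mul_sqrt_self _ (sqrt_mul_mul_sqrt_posSemidef B hA).nonneg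
  have hP : P.PosSemidef := (CFC.sqrt_nonneg _).posSemidef
  have hPt : Pᵀ = P := sqrt_transpose _
  let W₁ := W.submatrix id Sum.inl
  let W₂ := W.submatrix id Sum.inr
  have e11 : W₁ᵀ * W₁ = A := by
    ext i j; exact (congrFun (congrFun hW (.inl i)) (.inl j)).symm
  have e12 : W₁ᵀ * W₂ = C := by
    ext i j; exact (congrFun (congrFun hW (.inl i)) (.inr j)).symm
  have e22 : W₂ᵀ * W₂ = B := by
    ext i j; exact (congrFun (congrFun hW (.inr i)) (.inr j)).symm
  obtain ⟨U, hU, -, hU1⟩ := exists_polar_factor (W₁ * S) P hP.isHermitian (by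
    rw [transpose_mul, hSt, Matrix.mul_assoc, ← Matrix.mul_assoc W₁ᵀ, e11, hPP, Matrix.mul_assoc])
  obtain ⟨V, hV, -, hV1⟩ := exists_polar_factor W₂ S (CFC.sqrt_nonneg B).posSemidef.isHermitian
    (by rw [e22, hSS])
  have hC : C.trace = (P * (Uᵀ * V)).trace := by
    rw [← e12, hV, ← Matrix.mul_assoc, trace_mul_comm, ← Matrix.mul_assoc,
      show S * W₁ᵀ = P * Uᵀ by rw [← hPt, ← transpose_mul, ← hU, transpose_mul, hSt],
      Matrix.mul_assoc]
  have hsym : (P * (Vᵀ * U)).trace = (P * (Uᵀ * V)).trace := by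
    rw [← trace_transpose, transpose_mul, transpose_mul, hPt, transpose_transpose, trace_mul_comm]
  have h1 := trace_mul_nonneg hP hU1
  have h2 := trace_mul_nonneg hP hV1
  -- Weighted by `P`, the square of `U - V` bounds 2 Tr(P Uᵀ V) by Tr(P Uᵀ U) + Tr(P Vᵀ V), and both
  -- terms are at most Tr P since `U` and `V` are contractions.
  have h3 := trace_mul_nonneg hP (posSemidef_conjTranspose_mul_self (U - V))
  have h4 : P * ((U - V)ᴴ * (U - V)) = P * (Uᵀ * U) - P * (Uᵀ * V) - P * (Vᵀ * U) + P * (Vᵀ * V) := by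
    simp only [conjTranspose_eq_transpose_of_trivial, transpose_sub, Matrix.sub_mul,
      Matrix.mul_sub]
    abel
  rw [h4, trace_add, trace_sub, trace_sub, hsym] at h3
  rw [Matrix.mul_sub, Matrix.mul_one, trace_sub] at h1 h2
  linarith

/-- The fidelity of two positive semidefinite matrices is attained as the trace of the
off-diagonal block of a positive semidefinite block matrix. -/
theorem exists_fromBlocks_posSemidef_trace_eq {A B : Matrix n n ℝ} (hA : A.PosSemidef)
    (hB : B.PosSemidef) : ∃ C : Matrix n n ℝ, (fromBlocks A C Cᵀ B).PosSemidef ∧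
      C.trace = (CFC.sqrt (CFC.sqrt B * A * CFC.sqrt B)).trace := by
  set S := CFC.sqrt B with hS
  have hSS : S * S = B := CFC.sqrt_mul_sqrt_self B hB.nonneg
  have hSt : Sᵀ = S := sqrt_transpose B
  set T := CFC.sqrt A with hT
  have hTT : T * T = A := CFC.sqrt_mul_sqrt_self A hA.nonneg
  have hTt : Tᵀ = T := sqrt_transpose A
  set P := CFC.sqrt (S * A * S) with hPdef
  have hPP : P * P = S * A * S :=
    CFC.sqrt_mul_sqrt_self _ (sqrt_mul_mul_sqrt_posSemidef B hA).nonneg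
  have hP : P.PosSemidef := (CFC.sqrt_nonneg _).posSemidef
  obtain ⟨U, -, hU, hU1⟩ := exists_polar_factor (T * S) P hP.isHermitian (by
    rw [transpose_mul, hSt, hTt, Matrix.mul_assoc, ← Matrix.mul_assoc T, hTT, hPP,
      Matrix.mul_assoc])
  -- With K = T S, cyclicity gives Tr(T U S) = Tr(Kᵀ U) = Tr P. The Gram matrix of (T, U S) has this
  -- off-diagonal block; the defect of `U` supplies what its lower corner lacks.
  refine ⟨T * U * S, ?_, ?_⟩
  · have e : fromBlocks A (T * U * S) (T * U * S)ᵀ B =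
        (fromCols T (U * S))ᴴ * fromCols T (U * S) +
        (fromCols (0 : Matrix n n ℝ) S)ᴴ * (1 - Uᵀ * U) * fromCols 0 S := by
      simp only [conjTranspose_eq_transpose_of_trivial, transpose_fromCols, Matrix.fromRows_mul,
        Matrix.mul_fromCols, transpose_mul, hTt, hSt, transpose_zero]
      ext i j
      rcases i with i | i <;> rcases j with j | j <;>
        simp [← hTT, ← hSS, Matrix.mul_assoc, Matrix.mul_sub, Matrix.sub_mul]
    rw [e]
    exact (posSemidef_conjTranspose_mul_self _).add (hU1.conjTranspose_mul_mul_same _)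
  · rw [trace_mul_comm, ← Matrix.mul_assoc, ← hU, transpose_mul, hTt, hSt]

end

variable {d J : ℕ}

/-! ### Bordered matrices and the radius constraint. -/

/-- A positive semidefinite bordered matrix with vanishing corner has vanishing border. -/
theorem smul_inv_smul_of_bordered_posSemidef {A : Matrix (Fin d) (Fin d) ℝ}
    {v : EuclideanSpace ℝ (Fin d)} {c : ℝ} (h : (bordered A v c).PosSemidef) :
    c • c⁻¹ • v = v := by
  rcases eq_or_ne c 0 with rfl | hc
  · have h0 := (h.dotProduct_mulVec_zero_iff (Pi.single (Sum.inr ()) 1)).mp (by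
      simp [bordered])
    ext i
    have := congrFun h0 (Sum.inl i)
    simpa [bordered] using this.symm
  · rw [smul_smul, mul_inv_cancel₀ hc, one_smul]

/-- Schur complement A - v vᵀ / c, obtained by a congruence that eliminates the border. For c = 0
the convention `0⁻¹ = 0` leaves `A` itself. -/
theorem sub_vecMulVec_posSemidef_of_bordered {A : Matrix (Fin d) (Fin d) ℝ}
    {v : EuclideanSpace ℝ (Fin d)} {c : ℝ} (h : (bordered A v c).PosSemidef) :
    (A - c • vecMulVec (c⁻¹ • v).ofLp (c⁻¹ • v).ofLp).PosSemidef := by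
  convert h.conjTranspose_mul_mul_same
    (fromRows (1 : Matrix (Fin d) (Fin d) ℝ) (replicateRow Unit (-(c⁻¹ • v).ofLp))) using 1
  rw [conjTranspose_eq_transpose_of_trivial, transpose_fromRows, bordered, fromCols_mul_fromBlocks,
    fromCols_mul_fromRows]
  ext i j
  rcases eq_or_ne c 0 with rfl | hc
  · simp
  · simp [Matrix.mul_apply, vecMulVec_apply]
    field_simp
    ring

theorem bordered_sum {α : Type*} (s : Finset α) (Z : α → Matrix (Fin d) (Fin d) ℝ)
    (z : α → EuclideanSpace ℝ (Fin d)) (l : α → ℝ) :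
    ∑ a ∈ s, bordered (Z a) (z a) (l a) = bordered (∑ a ∈ s, Z a) (∑ a ∈ s, z a) (∑ a ∈ s, l a) := by
  ext i j
  rcases i with i | i <;> rcases j with j | j <;> simp [bordered, Matrix.sum_apply]

theorem bordered_sub (A B : Matrix (Fin d) (Fin d) ℝ) (v w : EuclideanSpace ℝ (Fin d)) (a b : ℝ) :
    bordered A v a - bordered B w b = bordered (A - B) (v - w) (a - b) := by
  ext i j
  rcases i with i | i <;> rcases j with j | j <;> simp [bordered]

/-- The homogenized vector `(θ, 1)`. -/
def homogenize (θ : EuclideanSpace ℝ (Fin d)) : Fin d ⊕ Unit → ℝ := Sum.elim θ.ofLp 1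

theorem bordered_vecMulVec (v : EuclideanSpace ℝ (Fin d)) :
    bordered (vecMulVec v.ofLp v.ofLp) v 1 = vecMulVec (homogenize v) (homogenize v) := by
  ext i j
  rcases i with i | i <;> rcases j with j | j <;> simp [bordered, homogenize, vecMulVec_apply]

theorem vecMulVec_self_posSemidef {m : Type*} [Fintype m] (v : m → ℝ) :
    (vecMulVec v v).PosSemidef := by
  simpa using posSemidef_vecMulVec_self_star v

/-- Since Tr(μ μᵀ) = ‖μ‖², the constraint linear in `M` is the Gelbrich expression for the
covariance M - μ μᵀ, with `C` in place of the fidelity root. -/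
theorem radius_eq (μ ν : EuclideanSpace ℝ (Fin d)) (M N C : Matrix (Fin d) (Fin d) ℝ) :
    ‖ν‖ ^ 2 - 2 * inner ℝ ν μ + (M + N - (2 : ℝ) • C).trace =
      ‖μ - ν‖ ^ 2 + (M - vecMulVec μ.ofLp μ.ofLp + N - (2 : ℝ) • C).trace := by
  have : (vecMulVec μ.ofLp μ.ofLp).trace = ‖μ‖ ^ 2 := by
    rw [trace_vecMulVec, ← real_inner_self_eq_norm_sq]; rfl
  rw [norm_sub_sq_real, real_inner_comm]
  simp only [trace_add, trace_sub, this]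
  ring

theorem mem_momentSet_iff {ν : EuclideanSpace ℝ (Fin d)} {N : Matrix (Fin d) (Fin d) ℝ} {ρ : ℝ}
    (hρ : 0 ≤ ρ) (p : EuclideanSpace ℝ (Fin d) × Matrix (Fin d) (Fin d) ℝ) :
    p ∈ momentSet ν N ρ ↔ p.2.PosSemidef ∧
      ‖p.1 - ν‖ ^ 2 + (p.2 + N - (2 : ℝ) • CFC.sqrt (CFC.sqrt N * p.2 * CFC.sqrt N)).trace ≤
        ρ ^ 2 := by
  rw [momentSet, Set.mem_ofPred_eq, gelbrichDist, Real.sqrt_le_left hρ]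

/-! ### Finitely supported laws with prescribed moments. -/

/-- The law of finitely many weighted atoms. -/
theorem exists_law_of_weights {ι : Type*} [Fintype ι] (w : ι → ℝ) (hw : ∀ i, 0 ≤ w i)
    (hw1 : ∑ i, w i = 1) (p : ι → EuclideanSpace ℝ (Fin d)) :
    ∃ Q : ProbabilityMeasure (EuclideanSpace ℝ (Fin d)),
      HasMeanCov Q (∑ i, w i • p i)
        (∑ i, w i • vecMulVec (p i).ofLp (p i).ofLp -
          vecMulVec (∑ i, w i • p i).ofLp (∑ i, w i • p i).ofLp) ∧
      ∀ T, MeasurableSet T →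
        (Q : Measure (EuclideanSpace ℝ (Fin d))).real T = ∑ i, w i * T.indicator 1 (p i) := by
  let : MeasurableSpace ι := ⊤
  have : DiscreteMeasurableSpace ι := ⟨fun _ => trivial⟩
  let π : PMF ι := PMF.ofFintype (fun i => ENNReal.ofReal (w i)) (by
    rw [← ENNReal.ofReal_sum_of_nonneg fun i _ => hw i, hw1, ENNReal.ofReal_one])
  have hp : Measurable p := measurable_from_top
  let Q₀ : Measure (EuclideanSpace ℝ (Fin d)) := π.toMeasure.map p
  have : IsProbabilityMeasure Q₀ := Measure.isProbabilityMeasure_map hp.aemeasurable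
  have hint : ∀ {F : Type} [NormedAddCommGroup F] [NormedSpace ℝ F] [CompleteSpace F]
      (f : EuclideanSpace ℝ (Fin d) → F), AEStronglyMeasurable f Q₀ →
      ∫ θ, f θ ∂Q₀ = ∑ i, w i • f (p i) := by
    intro F _ _ _ f hf
    rw [integral_map hp.aemeasurable hf, PMF.integral_eq_sum]
    exact Finset.sum_congr rfl fun i _ => by simp [π, ENNReal.toReal_ofReal (hw i)]
  have hmem : MemLp (fun θ : EuclideanSpace ℝ (Fin d) => θ) 2 Q₀ := by
    rw [memLp_map_measure_iff (by fun_prop) hp.aemeasurable]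
    exact MemLp.of_discrete
  refine ⟨⟨Q₀, inferInstance⟩, ⟨hmem, ?_, ?_⟩, ?_⟩
  · exact hint _ (by fun_prop)
  · intro i k
    change ProbabilityTheory.covariance _ _ Q₀ = _
    rw [ProbabilityTheory.covariance_eq_sub (hmem.eval_piLp i) (hmem.eval_piLp k)]
    simp only [Pi.mul_apply]
    rw [hint (fun θ => θ i * θ k) (by fun_prop), hint (fun θ => θ i) (by fun_prop),
      hint (fun θ => θ k) (by fun_prop)]
    simp [Matrix.sum_apply, vecMulVec_apply]
  · intro T hT
    change Q₀.real T = _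
    rw [← integral_indicator_one hT, hint _ (by fun_prop (disch := assumption))]
    rfl

/-- Every mean and every positive semidefinite covariance belong to a law with finitely many
atoms. -/
theorem exists_weights_of_posSemidef (μ : EuclideanSpace ℝ (Fin d))
    {R : Matrix (Fin d) (Fin d) ℝ} (hR : R.PosSemidef) :
    ∃ (w : Option (Fin d) × Bool → ℝ) (p : Option (Fin d) × Bool → EuclideanSpace ℝ (Fin d)),
      (∀ i, 0 ≤ w i) ∧ ∑ i, w i = 1 ∧ ∑ i, w i • p i = μ ∧
      ∑ i, w i • vecMulVec (p i).ofLp (p i).ofLp = R + vecMulVec μ.ofLp μ.ofLp := by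
  have hd : (0 : ℝ) < d + 1 := by positivity
  -- The atoms are μ ± t, with t a row of `T` or zero, all of equal weight; the factor d + 1 cancels
  -- the averaging over t. The extra index `none` keeps the support nonempty when d = 0.
  set T := CFC.sqrt (((d : ℝ) + 1) • R) with hT
  have hTT : T * T = ((d : ℝ) + 1) • R := CFC.sqrt_mul_sqrt_self _ (hR.smul hd.le).nonneg
  have hTt : Tᵀ = T := sqrt_transpose _
  let t : Option (Fin d) → EuclideanSpace ℝ (Fin d) :=
    fun o => o.elim 0 fun i => WithLp.toLp 2 (T i)
  refine ⟨fun _ => (2 * ((d : ℝ) + 1))⁻¹, fun a => if a.2 then μ + t a.1 else μ - t a.1,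
    fun _ => by positivity, ?_, ?_, ?_⟩
  · simp
    field_simp
  · rw [Fintype.sum_prod_type]
    have : ∀ o, ∑ b : Bool, ((2 * ((d : ℝ) + 1))⁻¹ • if b then μ + t o else μ - t o) =
        ((d : ℝ) + 1)⁻¹ • μ := by
      intro o
      simp only [Fintype.sum_bool, if_true, Bool.false_eq_true, if_false]
      rw [← smul_add, add_add_sub_cancel, ← two_smul ℝ μ, smul_smul]
      congr 1
      field_simp
    simp only [this]
    rw [Finset.sum_const, Finset.card_univ, Fintype.card_option, Fintype.card_fin,
      ← Nat.cast_smul_eq_nsmul ℝ, smul_smul]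
    push_cast
    rw [mul_inv_cancel₀ hd.ne', one_smul]
  · rw [Fintype.sum_prod_type]
    ext i k
    have hik : ∑ j, T j i * T j k = ((d : ℝ) + 1) * R i k := by
      have := congrFun (congrFun hTT i) k
      rw [Matrix.mul_apply, Matrix.smul_apply, smul_eq_mul] at this
      rw [← this]
      exact Finset.sum_congr rfl fun j _ => congrArg (· * T j k) (congrFun (congrFun hTt i) j)
    have : ∀ o, (∑ b : Bool, (2 * ((d : ℝ) + 1))⁻¹ •
        vecMulVec (if b then μ + t o else μ - t o).ofLp (if b then μ + t o else μ - t o).ofLp) i k =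
        ((d : ℝ) + 1)⁻¹ * (μ i * μ k) + ((d : ℝ) + 1)⁻¹ * (t o i * t o k) := by
      intro o
      simp [vecMulVec_apply]
      field_simp
      ring
    simp only [Matrix.sum_apply] at this ⊢
    simp only [this, Finset.sum_add_distrib, ← Finset.mul_sum, Fintype.sum_option]
    simp [t, hik, vecMulVec_apply]
    field_simp
    ring

/-- A decomposition of the second-moment matrix `[M, μ; μᵀ, 1]` into positive semidefinite blocks
is realized, up to an arbitrarily small loss of mass, by atoms at the means of the blocks. -/
theorem exists_law_of_bordered_decomposition {α : Type*} [Fintype α]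
    {M : Matrix (Fin d) (Fin d) ℝ} {μ : EuclideanSpace ℝ (Fin d)}
    {Z : α → Matrix (Fin d) (Fin d) ℝ} {z : α → EuclideanSpace ℝ (Fin d)} {l : α → ℝ}
    (hblock : ∀ a, (bordered (Z a) (z a) (l a)).PosSemidef)
    (hZ : ∑ a, Z a = M) (hz : ∑ a, z a = μ) (hl : ∑ a, l a = 1)
    (hM : (M - vecMulVec μ.ofLp μ.ofLp).PosSemidef) {ε : ℝ} (hε : 0 < ε) (hε1 : ε ≤ 1) :
    ∃ Q : ProbabilityMeasure (EuclideanSpace ℝ (Fin d)),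
      HasMeanCov Q μ (M - vecMulVec μ.ofLp μ.ofLp) ∧
      ∀ T, MeasurableSet T → ∀ s : Finset α, (∀ a ∈ s, (l a)⁻¹ • z a ∉ T) →
        (Q : Measure (EuclideanSpace ℝ (Fin d))).real T ≤ 1 - (1 - ε) * ∑ a ∈ s, l a := by
  classical
  have hl0 : ∀ a, 0 ≤ l a := fun a => by
    simpa [bordered] using (hblock a).diag_nonneg (i := Sum.inr ())
  set N : Matrix (Fin d) (Fin d) ℝ :=
    ∑ a, l a • vecMulVec ((l a)⁻¹ • z a).ofLp ((l a)⁻¹ • z a).ofLp with hN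
  have hMN : (M - N).PosSemidef := by
    rw [← hZ, hN, ← Finset.sum_sub_distrib]
    exact posSemidef_sum _ fun a _ => sub_vecMulVec_posSemidef_of_bordered (hblock a)
  -- `R` solves (1 - ε) N + ε (R + μ μᵀ) = M: the small component carries all the variance that the
  -- block means miss.
  set R := (M - vecMulVec μ.ofLp μ.ofLp) + (ε⁻¹ * (1 - ε)) • (M - N) with hR
  have hRpsd : R.PosSemidef :=
    hM.add (hMN.smul (mul_nonneg (inv_nonneg.mpr hε.le) (sub_nonneg.mpr hε1)))
  obtain ⟨w, p, hw0, hw1, hwp, hwpp⟩ := exists_weights_of_posSemidef μ hRpsd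
  let W : α ⊕ (Option (Fin d) × Bool) → ℝ := Sum.elim (fun a => (1 - ε) * l a) (fun i => ε * w i)
  let q : α ⊕ (Option (Fin d) × Bool) → EuclideanSpace ℝ (Fin d) :=
    Sum.elim (fun a => (l a)⁻¹ • z a) p
  have hW0 : ∀ i, 0 ≤ W i := by
    rintro (a | i)
    · exact mul_nonneg (sub_nonneg.mpr hε1) (hl0 a)
    · exact mul_nonneg hε.le (hw0 i)
  have hW1 : ∑ i, W i = 1 := by
    simp [W, Fintype.sum_sum_type, ← Finset.mul_sum, hl, hw1]
  have hWq : ∑ i, W i • q i = μ := by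
    simp only [W, q, Fintype.sum_sum_type, Sum.elim_inl, Sum.elim_inr, mul_smul,
      smul_inv_smul_of_bordered_posSemidef (hblock _), ← Finset.smul_sum, hz, hwp]
    rw [← add_smul, sub_add_cancel, one_smul]
  have hWqq : ∑ i, W i • vecMulVec (q i).ofLp (q i).ofLp = M := by
    simp only [W, q, Fintype.sum_sum_type, Sum.elim_inl, Sum.elim_inr, mul_smul,
      ← Finset.smul_sum, hwpp]
    rw [← hN, hR]
    ext i k
    simp
    field_simp
    ring
  obtain ⟨Q, hQ, hQT⟩ := exists_law_of_weights W hW0 hW1 q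
  rw [hWq, hWqq] at hQ
  refine ⟨Q, hQ, fun T hT s hs => ?_⟩
  rw [hQT T hT, le_sub_iff_add_le, Finset.mul_sum]
  have h1 : ∑ a ∈ s, (1 - ε) * l a = ∑ a ∈ s.map Function.Embedding.inl, W a := by
    simp [W]
  rw [h1, ← hW1, ← Finset.sum_add_sum_compl (s.map Function.Embedding.inl) (fun i => W i * _),
    ← Finset.sum_add_sum_compl (s.map Function.Embedding.inl) W]
  have h2 : ∑ i ∈ s.map Function.Embedding.inl, W i * T.indicator 1 (q i) = 0 := by
    refine Finset.sum_eq_zero fun i hi => ?_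
    obtain ⟨a, ha, rfl⟩ := Finset.mem_map.mp hi
    rw [Set.indicator_of_notMem (by exact hs a ha), mul_zero]
  have h3 : ∑ i ∈ (s.map Function.Embedding.inl)ᶜ, W i * T.indicator 1 (q i) ≤
      ∑ i ∈ (s.map Function.Embedding.inl)ᶜ, W i := by
    refine Finset.sum_le_sum fun i _ => mul_le_of_le_one_right (hW0 i) ?_
    exact Set.indicator_le_self' (fun _ _ => zero_le_one) _
  linarith

/-! ### From feasible points to laws. -/

theorem measurableSet_strictlyFavorable (x : Fin J → EuclideanSpace ℝ (Fin d)) :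
    MeasurableSet (strictlyFavorable x) := by
  have : strictlyFavorable x = ⋂ j, {θ | 0 < inner ℝ (x j) θ} := by
    ext θ; simp [strictlyFavorable]
  rw [this]
  exact MeasurableSet.iInter fun j => measurableSet_lt measurable_const (by fun_prop)

/-- Every feasible value of the semidefinite program is approximated from above by the
probability of the strictly favorable set under a law in the ambiguity set. -/
theorem SDPVars.Feasible.exists_mem_ambiguitySet {v : SDPVars d J}
    {x : Fin J → EuclideanSpace ℝ (Fin d)} {μhat : EuclideanSpace ℝ (Fin d)}
    {Shat : Matrix (Fin d) (Fin d) ℝ} {ρ : ℝ} (hρ : 0 ≤ ρ) (h : v.Feasible x μhat Shat ρ)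
    {ε : ℝ} (hε : 0 < ε) (hε1 : ε ≤ 1) :
    ∃ Q ∈ ambiguitySet μhat Shat ρ,
      (Q : Measure (EuclideanSpace ℝ (Fin d))).real (strictlyFavorable x) ≤ v.objective + ε := by
  have hsum := h.sum_le
  rw [bordered_sum, bordered_sub] at hsum
  have hschur := sub_vecMulVec_posSemidef_of_bordered h.schur
  rw [inv_one, one_smul, one_smul] at hschur
  have hcov : (v.M - vecMulVec v.μ.ofLp v.μ.ofLp).PosSemidef := by
    convert hschur.add h.S_psd using 1
    abel
  -- The index `none` holds the slack of the sum constraint, which completes the decomposition.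
  obtain ⟨Q, hQ, hQT⟩ := exists_law_of_bordered_decomposition (α := Option (Fin J))
    (M := v.M) (μ := v.μ) (Z := fun o => o.elim (v.M - ∑ j, v.Z j) v.Z)
    (z := fun o => o.elim (v.μ - ∑ j, v.z j) v.z) (l := fun o => o.elim (1 - ∑ j, v.lam j) v.lam)
    (by rintro (_ | j); exacts [hsum, h.block_psd j])
    (by simp [Fintype.sum_option]) (by simp [Fintype.sum_option]) (by simp [Fintype.sum_option])
    hcov hε hε1
  refine ⟨Q, ⟨(v.μ, _), (mem_momentSet_iff hρ _).mpr ⟨hcov, ?_⟩, hQ⟩, ?_⟩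
  -- The Schur constraint gives S ≤ M - μ μᵀ, so enlarging the first diagonal block to the actual
  -- covariance preserves positivity with the same `C`.
  · have hcoup : (fromBlocks (v.M - vecMulVec v.μ.ofLp v.μ.ofLp) v.C v.Cᵀ Shat).PosSemidef := by
      convert h.coupling.add ((hschur).conjTranspose_mul_mul_same
        (fromCols (1 : Matrix (Fin d) (Fin d) ℝ) (0 : Matrix (Fin d) (Fin d) ℝ))) using 1
      rw [conjTranspose_eq_transpose_of_trivial, transpose_fromCols]
      ext i j
      rcases i with i | i <;> rcases j with j | j <;>
        simp [Matrix.fromRows_mul, Matrix.mul_fromCols]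
      ring
    have htr := trace_le_of_fromBlocks_posSemidef hcoup
    have hrad := h.radius
    rw [radius_eq] at hrad
    simp only [trace_sub, trace_add, trace_smul, smul_eq_mul] at hrad ⊢
    linarith
  · have hlam : ∑ j, v.lam j ≤ 1 := by
      simpa [bordered] using hsum.diag_nonneg (i := Sum.inr ())
    -- Each atom z_j/λ_j violates its own strict inequality; when λ_j = 0 it is the origin, which
    -- violates it too.
    have := hQT _ (measurableSet_strictlyFavorable x) (Finset.univ.map Function.Embedding.some) (by
      intro a ha hmem
      obtain ⟨j, -, rfl⟩ := Finset.mem_map.mp ha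
      have h1 : 0 < inner ℝ (x j) ((v.lam j)⁻¹ • v.z j) := hmem j
      have h2 := h.halfspace j
      have h3 : 0 ≤ (v.lam j)⁻¹ := inv_nonneg.mpr (by
        simpa [bordered] using (h.block_psd j).diag_nonneg (i := Sum.inr ()))
      rw [inner_smul_right] at h1
      nlinarith [mul_nonneg h3 h2])
    simp only [Finset.sum_map, Function.Embedding.some_apply, Option.elim_some] at this
    rw [SDPVars.objective]
    nlinarith

/-! ### From laws to feasible points. -/

/-- The matrix of moments of order at most two of `Q` restricted to `A`. -/
noncomputable def momentMatrix (Q : Measure (EuclideanSpace ℝ (Fin d)))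
    (A : Set (EuclideanSpace ℝ (Fin d))) : Matrix (Fin d ⊕ Unit) (Fin d ⊕ Unit) ℝ :=
  Matrix.of fun a b => ∫ θ in A, homogenize θ a * homogenize θ b ∂Q

theorem memLp_homogenize {Q : Measure (EuclideanSpace ℝ (Fin d))} [IsFiniteMeasure Q]
    (h : MemLp (fun θ : EuclideanSpace ℝ (Fin d) => θ) 2 Q) (a : Fin d ⊕ Unit) :
    MemLp (fun θ => homogenize θ a) 2 Q := by
  rcases a with i | _
  · exact h.eval_piLp i
  · exact memLp_const 1

theorem integrable_homogenize_mul {Q : Measure (EuclideanSpace ℝ (Fin d))} [IsFiniteMeasure Q]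
    (h : MemLp (fun θ : EuclideanSpace ℝ (Fin d) => θ) 2 Q) (a b : Fin d ⊕ Unit) :
    Integrable (fun θ => homogenize θ a * homogenize θ b) Q :=
  (memLp_homogenize h a).integrable_mul (memLp_homogenize h b)

theorem momentMatrix_posSemidef {Q : Measure (EuclideanSpace ℝ (Fin d))} [IsFiniteMeasure Q]
    (h : MemLp (fun θ : EuclideanSpace ℝ (Fin d) => θ) 2 Q)
    (A : Set (EuclideanSpace ℝ (Fin d))) : (momentMatrix Q A).PosSemidef := by
  refine PosSemidef.of_dotProduct_mulVec_nonneg ?_ fun y => ?_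
  · ext a b
    simp [momentMatrix, mul_comm]
  · have hi := fun a b => (integrable_homogenize_mul h a b).integrableOn (s := A)
    -- The quadratic form is the integral of the square of an affine function of θ.
    have : star y ⬝ᵥ momentMatrix Q A *ᵥ y = ∫ θ in A, (∑ a, y a * homogenize θ a) ^ 2 ∂Q := by
      simp only [dotProduct, mulVec, momentMatrix, Matrix.of_apply, star_trivial]
      simp only [sq, Finset.sum_mul_sum]
      rw [integral_finsetSum _ fun a _ => integrable_finsetSum _ fun b _ =>
        (((hi a b).const_mul (y a * y b)).congr (.of_forall fun θ => by ring))]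
      refine Finset.sum_congr rfl fun a _ => ?_
      rw [integral_finsetSum _ fun b _ =>
        (((hi a b).const_mul (y a * y b)).congr (.of_forall fun θ => by ring)), Finset.mul_sum]
      refine Finset.sum_congr rfl fun b _ => ?_
      rw [mul_comm (∫ θ in A, _ ∂Q), ← integral_const_mul, ← integral_const_mul]
      congr 1; ext θ; ring
    rw [this]
    exact integral_nonneg fun θ => sq_nonneg _

/-- The parameters for which `x j` is the first constraint that is not strictly satisfied. -/
def firstViolation (x : Fin J → EuclideanSpace ℝ (Fin d)) (j : Fin J) :
    Set (EuclideanSpace ℝ (Fin d)) :=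
  {θ | inner ℝ (x j) θ ≤ 0} ∩ ⋂ i < j, {θ | 0 < inner ℝ (x i) θ}

theorem measurableSet_firstViolation (x : Fin J → EuclideanSpace ℝ (Fin d)) (j : Fin J) :
    MeasurableSet (firstViolation x j) :=
  (measurableSet_le (by fun_prop) measurable_const).inter
    (MeasurableSet.iInter fun i => MeasurableSet.iInter fun _ =>
      measurableSet_lt measurable_const (by fun_prop))

theorem pairwise_disjoint_firstViolation (x : Fin J → EuclideanSpace ℝ (Fin d)) :
    Pairwise fun i j => Disjoint (firstViolation x i) (firstViolation x j) := by
  have key : ∀ i j, i < j → Disjoint (firstViolation x i) (firstViolation x j) := by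
    intro i j hij
    refine Set.disjoint_left.mpr fun θ hi hj => ?_
    have h1 : inner ℝ (x i) θ ≤ 0 := hi.1
    have h2 : 0 < inner ℝ (x i) θ := Set.mem_iInter₂.mp hj.2 i hij
    exact absurd h1 h2.not_ge
  intro i j hij
  rcases lt_or_gt_of_ne hij with h | h
  exacts [key i j h, (key j i h).symm]

theorem iUnion_firstViolation (x : Fin J → EuclideanSpace ℝ (Fin d)) :
    ⋃ j, firstViolation x j = (strictlyFavorable x)ᶜ := by
  ext θ
  simp only [Set.mem_iUnion, Set.mem_compl_iff, strictlyFavorable, Set.mem_ofPred_eq]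
  constructor
  · rintro ⟨j, hj⟩ h
    have h1 : inner ℝ (x j) θ ≤ 0 := hj.1
    exact absurd h1 (h j).not_ge
  · intro h
    push Not at h
    obtain ⟨j, hj, hmin⟩ := WellFounded.has_min (wellFounded_lt (α := Fin J))
      {j | inner ℝ (x j) θ ≤ 0} h
    refine ⟨j, hj, Set.mem_iInter₂.mpr fun i hi => ?_⟩
    change 0 < inner ℝ (x i) θ
    exact not_le.mp fun hle => hmin i hle hi

/-- Applied to products of homogenized coordinates it identifies the slack of the sum constraint;
applied to f = 1, the objective. -/
theorem integral_sub_sum_firstViolation {Q : Measure (EuclideanSpace ℝ (Fin d))}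
    (x : Fin J → EuclideanSpace ℝ (Fin d)) {f : EuclideanSpace ℝ (Fin d) → ℝ}
    (hf : Integrable f Q) :
    ∫ θ, f θ ∂Q - ∑ j, ∫ θ in firstViolation x j, f θ ∂Q =
      ∫ θ in strictlyFavorable x, f θ ∂Q := by
  rw [← integral_iUnion_fintype (measurableSet_firstViolation x)
    (pairwise_disjoint_firstViolation x) (fun _ => hf.integrableOn), iUnion_firstViolation,
    ← integral_add_compl (measurableSet_strictlyFavorable x) hf, add_sub_cancel_right]

/-- The probability of the strictly favorable set under a law in the ambiguity set is a value of
the semidefinite program. -/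
theorem real_strictlyFavorable_mem_sdpValues {x : Fin J → EuclideanSpace ℝ (Fin d)}
    {μhat : EuclideanSpace ℝ (Fin d)} {Shat : Matrix (Fin d) (Fin d) ℝ}
    (hShat : Shat.PosSemidef) {ρ : ℝ} (hρ : 0 ≤ ρ)
    {Q : ProbabilityMeasure (EuclideanSpace ℝ (Fin d))} (hQ : Q ∈ ambiguitySet μhat Shat ρ) :
    (Q : Measure (EuclideanSpace ℝ (Fin d))).real (strictlyFavorable x) ∈
      sdpValues x μhat Shat ρ := by
  obtain ⟨⟨μ, S⟩, hp, hmem, hmean, hcov⟩ := hQ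
  obtain ⟨hS, hrad⟩ := (mem_momentSet_iff hρ _).mp hp
  dsimp only at hmean hcov hS hrad
  obtain ⟨C, hC, hCtr⟩ := exists_fromBlocks_posSemidef_trace_eq hS hShat
  have hi : ∀ i, Integrable (fun θ : EuclideanSpace ℝ (Fin d) => θ i)
      (Q : Measure (EuclideanSpace ℝ (Fin d))) :=
    fun i => (hmem.eval_piLp i).integrable one_le_two
  have hmean' : ∀ i, ∫ θ : EuclideanSpace ℝ (Fin d), θ i
      ∂(Q : Measure (EuclideanSpace ℝ (Fin d))) = μ i := by
    intro i
    rw [← hmean, eval_integral_piLp hi]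
  have hsecond : ∀ i k, ∫ θ : EuclideanSpace ℝ (Fin d), θ i * θ k
      ∂(Q : Measure (EuclideanSpace ℝ (Fin d))) = S i k + μ i * μ k := by
    intro i k
    have := ProbabilityTheory.covariance_eq_sub (hmem.eval_piLp i) (hmem.eval_piLp k)
    rw [hcov, hmean', hmean'] at this
    simp only [Pi.mul_apply] at this
    linarith
  let v : SDPVars d J :=
    { μ := μ
      S := S
      C := C
      M := S + vecMulVec μ.ofLp μ.ofLp
      lam := fun j => (Q : Measure (EuclideanSpace ℝ (Fin d))).real (firstViolation x j)
      z := fun j => WithLp.toLp 2 fun i =>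
        ∫ θ in firstViolation x j, θ i ∂(Q : Measure (EuclideanSpace ℝ (Fin d)))
      Z := fun j => Matrix.of fun i k =>
        ∫ θ in firstViolation x j, θ i * θ k ∂(Q : Measure (EuclideanSpace ℝ (Fin d))) }
  have hblock : ∀ j, bordered (v.Z j) (v.z j) (v.lam j) =
      momentMatrix (Q : Measure (EuclideanSpace ℝ (Fin d))) (firstViolation x j) := by
    intro j
    ext a b
    rcases a with a | a <;> rcases b with b | b <;> simp [v, bordered, momentMatrix, homogenize]
  have hfull : bordered v.M v.μ 1 =
      momentMatrix (Q : Measure (EuclideanSpace ℝ (Fin d))) Set.univ := by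
    ext a b
    rcases a with a | a <;> rcases b with b | b <;>
      simp [v, bordered, momentMatrix, homogenize, vecMulVec_apply, hmean', hsecond]
  refine ⟨v, ⟨hS, hS.add (vecMulVec_self_posSemidef _), ?_, ?_, ?_, ?_, hC, ?_, ?_⟩, ?_⟩
  · intro j
    ext i k
    simp [v, mul_comm]
  · intro j
    have : inner ℝ (x j) (v.z j) = ∫ θ in firstViolation x j, inner ℝ (x j) θ
        ∂(Q : Measure (EuclideanSpace ℝ (Fin d))) := by
      simp only [PiLp.inner_apply, v]
      rw [integral_finsetSum _ fun i _ => by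
        simpa using ((hi i).integrableOn.mul_const _)]
      exact Finset.sum_congr rfl fun i _ => by simp [integral_mul_const]
    rw [this, Left.nonneg_neg_iff]
    exact setIntegral_nonpos (measurableSet_firstViolation x j) fun θ hθ => hθ.1
  · intro j
    rw [hblock]
    exact momentMatrix_posSemidef hmem _
  · simp only [hblock, hfull]
    convert momentMatrix_posSemidef hmem (strictlyFavorable x) using 1
    ext a b
    simp only [Matrix.sub_apply, Matrix.sum_apply, momentMatrix, Matrix.of_apply,
      Measure.restrict_univ]
    exact integral_sub_sum_firstViolation x (integrable_homogenize_mul hmem a b)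
  -- Here M - S = μ μᵀ exactly, so the Schur block is the rank-one matrix of (μ, 1).
  · have : v.M - v.S = vecMulVec μ.ofLp μ.ofLp := add_sub_cancel_left _ _
    rw [this, show v.μ = μ from rfl, bordered_vecMulVec]
    exact vecMulVec_self_posSemidef _
  · rw [radius_eq, show v.M - vecMulVec v.μ.ofLp v.μ.ofLp = S from add_sub_cancel_right _ _]
    simp only [trace_sub, trace_add, trace_smul, ← hCtr, v] at hrad ⊢
    exact hrad
  · have := integral_sub_sum_firstViolation x
      (integrable_const (μ := (Q : Measure (EuclideanSpace ℝ (Fin d)))) (1 : ℝ))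
    simpa [SDPVars.objective, v] using this.symm

/-! ### Finiteness, nonemptiness and the conclusion. -/

/-- The objective is the corner entry of the positive semidefinite slack. -/
theorem sdpValues_nonneg {x : Fin J → EuclideanSpace ℝ (Fin d)}
    {μhat : EuclideanSpace ℝ (Fin d)} {Shat : Matrix (Fin d) (Fin d) ℝ} {ρ t : ℝ}
    (ht : t ∈ sdpValues x μhat Shat ρ) : 0 ≤ t := by
  obtain ⟨v, hv, rfl⟩ := ht
  have h := hv.sum_le
  rw [bordered_sum, bordered_sub] at h
  simpa [bordered, SDPVars.objective] using h.diag_nonneg (i := Sum.inr ())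

/-- The nominal pair is realized by a discrete law and has Gelbrich distance zero from itself. -/
theorem ambiguitySet_nonempty (μhat : EuclideanSpace ℝ (Fin d))
    {Shat : Matrix (Fin d) (Fin d) ℝ} (hShat : Shat.PosSemidef) {ρ : ℝ} (hρ : 0 ≤ ρ) :
    (ambiguitySet μhat Shat ρ).Nonempty := by
  obtain ⟨w, p, hw0, hw1, hwp, hwpp⟩ := exists_weights_of_posSemidef μhat hShat
  obtain ⟨Q, hQ, -⟩ := exists_law_of_weights w hw0 hw1 p
  rw [hwp, hwpp, add_sub_cancel_right] at hQ
  refine ⟨Q, (μhat, Shat), (mem_momentSet_iff hρ _).mpr ⟨hShat, ?_⟩, hQ⟩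
  have hss := CFC.sqrt_mul_sqrt_self Shat hShat.nonneg
  have : CFC.sqrt (CFC.sqrt Shat * Shat * CFC.sqrt Shat) = Shat := by
    refine CFC.sqrt_unique ?_ hShat.nonneg
    calc Shat * Shat
        = CFC.sqrt Shat * CFC.sqrt Shat * (CFC.sqrt Shat * CFC.sqrt Shat) := by rw [hss]
      _ = CFC.sqrt Shat * (CFC.sqrt Shat * CFC.sqrt Shat) * CFC.sqrt Shat := by
        simp only [Matrix.mul_assoc]
      _ = CFC.sqrt Shat * Shat * CFC.sqrt Shat := by rw [hss]
  simp only [this, two_smul, sub_self, norm_zero, trace_zero]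
  nlinarith

end CounterfactualPlan

theorem theorem1 (d J : ℕ) (x : Fin J → EuclideanSpace ℝ (Fin d))
    (μhat : EuclideanSpace ℝ (Fin d)) (Shat : Matrix (Fin d) (Fin d) ℝ)
    (hShat : Shat.PosSemidef) (ρ : ℝ) (hρ : 0 ≤ ρ) :
    -- both infima are over nonempty sets, and the optimal value is a genuine (finite) infimum
    IsGLB (CounterfactualPlan.sdpValues x μhat Shat ρ)
      (CounterfactualPlan.sdpOptimalValue x μhat Shat ρ) ∧
    (CounterfactualPlan.ambiguitySet μhat Shat ρ).Nonempty ∧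
    -- the optimal value is the worst-case probability of the strictly favorable set
    CounterfactualPlan.sdpOptimalValue x μhat Shat ρ =
      (⨅ Q : CounterfactualPlan.ambiguitySet μhat Shat ρ,
        (Q.1 : Measure (EuclideanSpace ℝ (Fin d))).real
          (CounterfactualPlan.strictlyFavorable x)) ∧
    -- which is at most the worst-case probability that the plan is valid
    (⨅ Q : CounterfactualPlan.ambiguitySet μhat Shat ρ,
        (Q.1 : Measure (EuclideanSpace ℝ (Fin d))).real
          (CounterfactualPlan.strictlyFavorable x)) ≤
      (⨅ Q : CounterfactualPlan.ambiguitySet μhat Shat ρ,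
        (Q.1 : Measure (EuclideanSpace ℝ (Fin d))).real
          (CounterfactualPlan.favorable x)) := by
  -- Real infima default to 0 on empty or unbounded-below families, so nonemptiness and lower bounds
  -- are secured beforehand.
  have hne := CounterfactualPlan.ambiguitySet_nonempty μhat hShat hρ
  have : Nonempty (CounterfactualPlan.ambiguitySet μhat Shat ρ) := hne.to_subtype
  have hvals : (CounterfactualPlan.sdpValues x μhat Shat ρ).Nonempty :=
    let ⟨_, hQ⟩ := hne
    ⟨_, CounterfactualPlan.real_strictlyFavorable_mem_sdpValues hShat hρ hQ⟩
  have hbdd : BddBelow (CounterfactualPlan.sdpValues x μhat Shat ρ) :=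
    ⟨0, fun _ ht => CounterfactualPlan.sdpValues_nonneg ht⟩
  have hbdd' : ∀ A : Set (EuclideanSpace ℝ (Fin d)),
      BddBelow (Set.range fun Q : CounterfactualPlan.ambiguitySet μhat Shat ρ =>
        (Q.1 : Measure (EuclideanSpace ℝ (Fin d))).real A) :=
    fun A => ⟨0, by rintro _ ⟨Q, rfl⟩; exact measureReal_nonneg⟩
  refine ⟨isGLB_csInf hvals hbdd, hne, le_antisymm ?_ ?_, ?_⟩
  · exact le_ciInf fun Q => csInf_le hbdd
      (CounterfactualPlan.real_strictlyFavorable_mem_sdpValues hShat hρ Q.2)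
  · refine le_csInf hvals ?_
    rintro _ ⟨v, hv, rfl⟩
    refine le_of_forall_pos_le_add fun ε hε => ?_
    -- The mixing weight is min ε 1, as a weight cannot exceed 1.
    obtain ⟨Q, hQ, hle⟩ := hv.exists_mem_ambiguitySet hρ (lt_min hε one_pos) (min_le_right ε 1)
    exact (ciInf_le (hbdd' _) ⟨Q, hQ⟩).trans
      (hle.trans (add_le_add_right (min_le_left ε 1) _))
  · exact ciInf_mono (hbdd' _) fun Q => measureReal_mono fun θ hθ j => (hθ j).le
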